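/- For integers $n,m\ge 0$ and $p\in[0,1]$ let $\mathbb{H}(n,m,p)$ be the random hypergraph with vertex set $V=\{v_1,\dots,v_n\}$ and edges $e_1,\dots,e_m$ (duplicate edges allowed) in which each vertex is placed in each edge independently with probability $p$. For a hypergraph $H=(V,\{e_1,\dots,e_m\})$ let $$\operatorname{disc}(H)=\min_{\psi:V\to\{-1,1\}}\ \max_{1\le i\le m}\Big|\sum_{v\in e_i}\psi(v)\Big| ,$$ where the maximum is $0$ if $m=0$. **Theorem.** For every $\varepsilon>0$ there is a constant $c>0$, depending only on $\varepsilon$, such that the following holds for all $m=m(n)\in\mathbb{N}$ and $p=p(n)\in[0,1]$ such that $p\le 1-\varepsilon$ for all sufficiently large $n$, $pn\to\infty$ and $pm\to\infty$ as $n\to\infty$. Let $H=H(n)$ be drawn from $\mathbb{H}(n,m,p)$. 1. If $m=O(n)$, then $$\lim_{n\to\infty}\mathbb{P}\left[\operatorname{disc}(H)\ \ge\ c\,\max\{2^{-n/m}\sqrt{pn},\,1\}\right]=1 .$$ 2. If $m\gg n$ (that is, $n/m\to 0$), then $$\lim_{n\to\infty}\mathbb{P}\left[\operatorname{disc}(H)\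 \ge\ c\,\sqrt{pn\log\gamma}\right]=1,\qquad\text{where }\gamma=\min\{m/n,\,pn\}.$$ -/

import Mathlib

open Filter Topology MeasureTheory ProbabilityTheory Asymptotics

/-- A hypergraph on the vertex type `V` whose edges are labelled by `ι`; duplicate edges
(`edge i = edge i'` with `i ≠ i'`) and empty edges are allowed. -/
@[ext]
structure MultiHypergraph (V ι : Type*) where
  /-- The edge with label `i`. -/
  edge : ι → Finset V

namespace MultiHypergraph

variable {V ι : Type*}

/-- The hypergraph with incidence matrix `A`: the vertex `v` lies in the edge `i` exactly when
`A i v` is `true`. -/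
def ofIncidence [Fintype V] (A : ι → V → Bool) : MultiHypergraph V ι where
  edge i := Finset.univ.filter fun v => A i v = true

/-- The discrepancy `|∑ v ∈ e, ψ v|` of the edge `e` with label `i` under the colouring `ψ`.
The type `ℤˣ` has exactly the two elements `1` and `-1`. -/
def edgeDisc (H : MultiHypergraph V ι) (ψ : V → ℤˣ) (i : ι) : ℕ :=
  (∑ v ∈ H.edge i, (ψ v : ℤ)).natAbs

/-- The discrepancy of a colouring: the maximum of the edge discrepancies (`0` without edges). -/
def colouringDisc [Fintype ι] (H : MultiHypergraph V ι) (ψ : V → ℤˣ) : ℕ :=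
  Finset.univ.sup fun i => H.edgeDisc ψ i

/-- The discrepancy of a hypergraph: the minimum over all colourings of the discrepancy of the
colouring. -/
def disc [Fintype V] [DecidableEq V] [Fintype ι] (H : MultiHypergraph V ι) : ℕ :=
  Finset.univ.inf' Finset.univ_nonempty fun ψ : V → ℤˣ => H.colouringDisc ψ

/-- Every set of hypergraphs is an event. -/
instance instMeasurableSpace : MeasurableSpace (MultiHypergraph V ι) := ⊤

end MultiHypergraph

/-- The law of an `m × n` matrix whose entries are independent Bernoulli variables with
parameter `p` (`true` with probability `p`). -/
noncomputable def bernoulliMatrix (n m : ℕ) (p : unitInterval) :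
    Measure (Fin m → Fin n → Bool) :=
  Measure.pi fun _ => Measure.pi fun _ => bernoulliMeasure true false p

/-- The edge-independent random hypergraph on `n` vertices with `m` edges: each vertex joins each
edge independently with probability `p`. -/
noncomputable def edgeIndependent (n m : ℕ) (p : unitInterval) :
    Measure (MultiHypergraph (Fin n) (Fin m)) :=
  (bernoulliMatrix n m p).map MultiHypergraph.ofIncidence

instance instIsProbabilityMeasureBernoulliMatrix (n m : ℕ) (p : unitInterval) :
    IsProbabilityMeasure (bernoulliMatrix n m p) := by
  unfold bernoulliMatrix; infer_instance

theorem measurable_ofIncidence (n m : ℕ) :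
    Measurable (MultiHypergraph.ofIncidence : (Fin m → Fin n → Bool) → _) :=
  measurable_of_finite _

instance instIsProbabilityMeasureEdgeIndependent (n m : ℕ) (p : unitInterval) :
    IsProbabilityMeasure (edgeIndependent n m p) :=
  Measure.isProbabilityMeasure_map (measurable_ofIncidence n m).aemeasurable

/-! Both parts are first moment arguments over the `2 ^ n` colourings. For a fixed `ψ` the edges are
independent, so if each has discrepancy below `t` with probability at most `r`, some colouring
succeeds on all `m` edges with probability at most `2 ^ n * r ^ m`
(`edgeIndependent_real_disc_lt_le`). It remains to bound `r` uniformly in `ψ`. The signed sum over a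
random edge is a difference of two independent binomials, one on each colour class, and one class
contains at least half of the vertices.

For `m = O(n)`, binomial atoms of mass `O(1 / √(pn))` give `r = O(t / √(pn))` once `t ≥ 1`; the
choice `t = c * 2 ^ (-n/m) * √(pn)` makes `r ≤ 2 ^ (-n/m) / 2`, which absorbs the factor `2 ^ n`. If
the required threshold is at most `1`, a parity argument replaces the union bound: discrepancy `0`
forces every edge to have even size, whatever the colouring.

For `m ≫ n`, a reverse tail bound shows that an edge reaches `t = c * √(pn log γ)` with probability
at least `(m/n) ^ (-1/2) / 4`. The expected number of such edges is then of order `√(mn)`, which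
dominates `n`, so independence beats `2 ^ n`.

Both binomial estimates come from the ratio of consecutive atoms: within `s` above the mean `μ`, one
step to the right costs a factor of at least `exp (-O((s + 1) / μ))`. -/

/-! ### The binomial distribution -/

section Binomial

variable {a : ℕ} {p : unitInterval} {ε : ℝ}

theorem binomial_real_succ_mul (a k : ℕ) (p : unitInterval) :
    (binomial a p).real {k + 1} * ((k + 1) * (1 - p)) =
      (binomial a p).real {k} * ((a - k) * p) := by
  rw [binomial_real_singleton, binomial_real_singleton]
  rcases lt_trichotomy k a with h | rfl | h
  · have h1 : (a.choose (k + 1) : ℝ) * (k + 1) = a.choose k * (a - k) := by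
      have := Nat.choose_succ_right_eq a k
      rw [← Nat.cast_sub h.le]
      exact_mod_cast this
    obtain ⟨d, rfl⟩ : ∃ d, a = k + 1 + d := ⟨a - (k + 1), by omega⟩
    have e1 : k + 1 + d - (k + 1) = d := by omega
    have e2 : k + 1 + d - k = d + 1 := by omega
    rw [e1, e2]
    linear_combination (p : ℝ) ^ (k + 1) * (1 - p) ^ (d + 1) * h1
  · simp
  · simp [Nat.choose_eq_zero_of_lt h, Nat.choose_eq_zero_of_lt (h.trans (Nat.lt_succ_self k))]

theorem binomial_real_succ_le {k : ℕ} (hp : (p : ℝ) < 1) (hk : (a : ℝ) * p ≤ k) :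
    (binomial a p).real {k + 1} ≤ (binomial a p).real {k} := by
  have h := binomial_real_succ_mul a k p
  have hp0 : (0 : ℝ) ≤ p := p.2.1
  have hpos : (0 : ℝ) < (k + 1) * (1 - p) := by
    have : (0 : ℝ) < 1 - p := by linarith
    positivity
  refine le_of_mul_le_mul_right ?_ hpos
  rw [h]
  refine mul_le_mul_of_nonneg_left ?_ measureReal_nonneg
  nlinarith

/-- With `x = (s + 1) / (a p)` and `y = x / ε`, the ratio of the two atoms is at least `(1 - y) / (1
+ x)`. The bound `1 - p ≥ ε` is what turns the loss in `a - k` into a relative loss of at most `y`.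
-/
theorem binomial_real_le_succ {s : ℝ} {k : ℕ} (hε : 0 < ε) (hp : (p : ℝ) ≤ 1 - ε)
    (hμ : 0 < (a : ℝ) * p) (hs : 0 ≤ s) (hx : (s + 1) / (a * p) ≤ ε / 2) (hk : (k : ℝ) ≤ a * p + s) :
    Real.exp (-(3 / ε * ((s + 1) / (a * p)))) * (binomial a p).real {k} ≤
      (binomial a p).real {k + 1} := by
  have h := binomial_real_succ_mul a k p
  have hp0 : (0 : ℝ) ≤ p := p.2.1
  have hq : (0 : ℝ) < 1 - p := by linarith
  have hpos : (0 : ℝ) < (k + 1) * (1 - p) := by positivity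
  refine le_of_mul_le_mul_right ?_ hpos
  rw [h]
  set μ : ℝ := a * p with hμdef
  set x : ℝ := (s + 1) / μ with hxdef
  have hxμ : x * μ = s + 1 := by rw [hxdef]; field_simp
  set y : ℝ := x / ε with hydef
  have hyx : x = ε * y := by rw [hydef]; field_simp
  have hx0 : 0 ≤ x := by positivity
  have hy0 : 0 ≤ y := by positivity
  have hε1 : ε ≤ 1 := by linarith
  have hy1 : y ≤ 1 / 2 := by rw [hydef, div_le_iff₀ hε]; linarith
  -- The constant `3` splits as `1 + 2`: one `y` pays for `1 + x ≤ exp y`, and two pay for `exp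
  -- (-2y) ≤ 1 - y`, valid since `y ≤ 1/2`.
  have key : Real.exp (-(3 / ε * x)) * (1 + x) ≤ 1 - y := by
    have e1 : 3 / ε * x = 2 * y + y := by rw [hydef]; ring
    have h1 : 1 + x ≤ Real.exp y := by
      have := Real.add_one_le_exp y
      nlinarith
    have h2 : Real.exp (-(2 * y)) ≤ 1 - y := by
      rw [Real.exp_neg, inv_le_comm₀ (Real.exp_pos _) (by linarith)]
      have := Real.add_one_le_exp (2 * y)
      refine le_trans ?_ this
      rw [inv_le_iff_one_le_mul₀ (by linarith)]
      nlinarith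
    calc Real.exp (-(3 / ε * x)) * (1 + x) ≤ Real.exp (-(3 / ε * x)) * Real.exp y := by gcongr
      _ = Real.exp (-(2 * y)) := by rw [← Real.exp_add, e1]; ring_nf
      _ ≤ _ := h2
  have h1 : ((k : ℝ) + 1) * (1 - p) ≤ (1 + x) * (μ * (1 - p)) := by nlinarith
  have h2 : (1 - y) * (μ * (1 - p)) ≤ (a - k) * p := by
    have h3 : s * p ≤ y * μ * (1 - p) := by
      have : s ≤ y * μ * ε := by nlinarith
      have : y * μ * ε ≤ y * μ * (1 - p) := by
        have : 0 ≤ y * μ := by positivity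
        nlinarith
      have : s * p ≤ s * 1 := mul_le_mul_of_nonneg_left p.2.2 hs
      linarith
    nlinarith
  calc Real.exp (-(3 / ε * x)) * (binomial a p).real {k} * ((k + 1) * (1 - p))
      = (binomial a p).real {k} * (Real.exp (-(3 / ε * x)) * ((k + 1) * (1 - p))) := by ring
    _ ≤ (binomial a p).real {k} * ((a - k) * p) := by
      refine mul_le_mul_of_nonneg_left ?_ measureReal_nonneg
      calc Real.exp (-(3 / ε * x)) * ((k + 1) * (1 - p))
          ≤ Real.exp (-(3 / ε * x)) * ((1 + x) * (μ * (1 - p))) := by gcongr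
        _ = (Real.exp (-(3 / ε * x)) * (1 + x)) * (μ * (1 - p)) := by ring
        _ ≤ (1 - y) * (μ * (1 - p)) := by gcongr
        _ ≤ _ := h2

theorem binomial_real_le_add {s : ℝ} {k : ℕ} (hε : 0 < ε) (hp : (p : ℝ) ≤ 1 - ε)
    (hμ : 0 < (a : ℝ) * p) (hs : 0 ≤ s) (hx : (s + 1) / (a * p) ≤ ε / 2) (T : ℕ)
    (hk : (k : ℝ) + T ≤ a * p + s) :
    Real.exp (-(3 / ε * ((s + 1) / (a * p)) * T)) * (binomial a p).real {k} ≤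
      (binomial a p).real {k + T} := by
  induction T with
  | zero => simp
  | succ T ih =>
    push_cast at hk
    have h1 := ih (by linarith)
    have h2 := binomial_real_le_succ (k := k + T) hε hp hμ hs hx (by push_cast; linarith)
    refine le_trans ?_ h2
    calc _ = Real.exp (-(3 / ε * ((s + 1) / (a * p)))) *
        (Real.exp (-(3 / ε * ((s + 1) / (a * p)) * T)) * (binomial a p).real {k}) := by
          rw [← mul_assoc, ← Real.exp_add]; push_cast; ring_nf
      _ ≤ _ := by gcongr

/-- Every atom of `Bin(a, p)` has mass `O(1 / √(a p))` when `p` is bounded away from `1`. -/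
theorem binomial_real_singleton_le (hε : 0 < ε) (hp : (p : ℝ) ≤ 1 - ε)
    (hμ : 0 < (a : ℝ) * p) (k : ℕ) :
    (binomial a p).real {k} ≤ Real.exp (12 / ε) / √(a * p) := by
  have hp0 : (0 : ℝ) ≤ p := p.2.1
  set r := √((a : ℝ) * p) with hr
  have hr0 : 0 < r := Real.sqrt_pos.2 hμ
  have hrr : r * r = a * p := Real.mul_self_sqrt hμ.le
  -- For small `r` the claimed bound exceeds `1`.
  rcases lt_or_ge r (8 / ε) with hsmall | hlarge
  · refine measureReal_le_one.trans ?_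
    rw [le_div_iff₀ hr0]
    have := Real.add_one_le_exp (12 / ε)
    have : 8 / ε ≤ 12 / ε := by gcongr; norm_num
    linarith
  have hr1 : 1 ≤ r := by
    refine le_trans ?_ hlarge
    rw [le_div_iff₀ hε]
    linarith
  -- Up to just past the mean, the next `⌊r⌋₊` atoms are each at least `exp (-12/ε)` times the atom
  -- at `k`, and together they have mass at most `1`. The slack `+ 1` lets the induction below cross
  -- the mean; beyond it the atoms decrease.
  have low (k : ℕ) (hk : (k : ℝ) ≤ a * p + 1) :
      (binomial a p).real {k} ≤ Real.exp (12 / ε) / r := by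
    have hxr : (r + 1 + 1) / (a * p) ≤ 4 / r := by
      rw [← hrr, div_le_div_iff₀ (by positivity) hr0]
      nlinarith
    have hx : (r + 1 + 1) / (a * p) ≤ ε / 2 := by
      refine hxr.trans ?_
      rw [div_le_iff₀ hr0]
      rw [div_le_iff₀ hε] at hlarge
      linarith
    have hT : (⌊r⌋₊ : ℝ) ≤ r := Nat.floor_le hr0.le
    have each (j : ℕ) (hj : j ∈ Finset.range (⌊r⌋₊ + 1)) :
        Real.exp (-(12 / ε)) * (binomial a p).real {k} ≤ (binomial a p).real {k + j} := by
      have hjr : (j : ℝ) ≤ r := by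
        have : j ≤ ⌊r⌋₊ := by simpa [Nat.lt_succ_iff] using hj
        exact le_trans (by exact_mod_cast this) hT
      refine le_trans ?_ (binomial_real_le_add hε hp hμ (s := r + 1) (by linarith) hx j
        (by linarith))
      refine mul_le_mul_of_nonneg_right ?_ measureReal_nonneg
      rw [Real.exp_le_exp, neg_le_neg_iff]
      calc 3 / ε * ((r + 1 + 1) / (a * p)) * j ≤ 3 / ε * (4 / r) * r := by gcongr
        _ = 12 / ε := by field_simp; norm_num
    have hsum := Finset.sum_le_sum each
    rw [Finset.sum_const, Finset.card_range, nsmul_eq_mul] at hsum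
    have htot : ∑ j ∈ Finset.range (⌊r⌋₊ + 1), (binomial a p).real {k + j} ≤ 1 := by
      have := sum_measureReal_singleton (μ := binomial a p)
        ((Finset.range (⌊r⌋₊ + 1)).image (k + ·))
      rw [Finset.sum_image (by intro i _ j _ h; simpa using h)] at this
      rw [this]
      exact measureReal_le_one
    have hfl : r ≤ ((⌊r⌋₊ + 1 : ℕ) : ℝ) := by push_cast; exact (Nat.lt_floor_add_one r).le
    rw [le_div_iff₀ hr0]
    have h3 : r * (Real.exp (-(12 / ε)) * (binomial a p).real {k}) ≤ 1 :=
      le_trans (mul_le_mul_of_nonneg_right hfl (by positivity)) (hsum.trans htot)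
    rw [Real.exp_neg] at h3
    have hE := Real.exp_pos (12 / ε)
    calc (binomial a p).real {k} * r
        = Real.exp (12 / ε) * (r * ((Real.exp (12 / ε))⁻¹ * (binomial a p).real {k})) := by
          field_simp
      _ ≤ Real.exp (12 / ε) * 1 := by gcongr
      _ = _ := mul_one _
  induction k with
  | zero => exact low 0 (by push_cast; linarith)
  | succ k ih =>
    rcases le_or_gt ((a : ℝ) * p) k with h | h
    · exact (binomial_real_succ_le (by linarith) h).trans ih
    · exact low _ (by push_cast; linarith)

theorem integral_binomial_sub_sq (a : ℕ) (p : unitInterval) :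
    ∫ k : ℕ, ((k : ℝ) - a * p) ^ 2 ∂(binomial a p) = a * p * (1 - p) := by
  rw [integral_binomial]
  have h := congrArg (Polynomial.eval (p : ℝ)) (bernsteinPolynomial.variance ℝ a)
  simp only [Polynomial.eval_finsetSum, bernsteinPolynomial, Polynomial.eval_mul,
    Polynomial.eval_pow, Polynomial.eval_sub, Polynomial.eval_natCast, Polynomial.eval_X,
    Polynomial.eval_one, nsmul_eq_mul] at h
  have e : Finset.Iic a = Finset.range (a + 1) := by ext; simp
  rw [e, mul_assoc, ← mul_assoc, ← h]
  refine Finset.sum_congr rfl fun k _ => ?_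
  simp only [smul_eq_mul]
  ring

/-- Chebyshev's inequality for the binomial distribution. -/
theorem binomial_real_abs_sub_ge_le {s : ℝ} (hs : 0 < s) (a : ℕ) (p : unitInterval) :
    (binomial a p).real {k : ℕ | s ≤ |(k : ℝ) - a * p|} ≤ a * p / s ^ 2 := by
  have h := mul_meas_ge_le_integral_of_nonneg (μ := binomial a p)
    (f := fun k : ℕ => ((k : ℝ) - a * p) ^ 2) (ae_of_all _ fun _ => by positivity)
    (integrable_binomial _) (s ^ 2)
  rw [integral_binomial_sub_sq] at h
  have e : {k : ℕ | s ^ 2 ≤ ((k : ℝ) - a * p) ^ 2} = {k : ℕ | s ≤ |(k : ℝ) - a * p|} := by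
    ext k
    simp only [Set.mem_ofPred_eq]
    rw [← sq_abs ((k : ℝ) - a * p), sq_le_sq₀ hs.le (abs_nonneg _)]
  rw [e] at h
  rw [le_div_iff₀ (by positivity), mul_comm]
  refine h.trans ?_
  have hp0 : (0 : ℝ) ≤ p := p.2.1
  have : (0 : ℝ) ≤ a * p := by positivity
  nlinarith

/-- A lower bound for the upper tail of `Bin(a, p)` in the moderate deviations regime. -/
theorem le_binomial_real_tail {t : ℝ} (hε : 0 < ε) (hp : (p : ℝ) ≤ 1 - ε)
    (hμ : 1 ≤ (a : ℝ) * p) (ht : √((a : ℝ) * p) ≤ t) (ht' : t ≤ ε * (a * p) / 14) :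
    1 / 2 * Real.exp (-(84 / ε * (t ^ 2 / (a * p)))) ≤
      (binomial a p).real {k : ℕ | (a : ℝ) * p + t ≤ k} := by
  have hμ0 : 0 < (a : ℝ) * p := by linarith
  set r := √((a : ℝ) * p) with hr
  have hr1 : 1 ≤ r := Real.one_le_sqrt.2 hμ
  have hrr : r * r = a * p := Real.mul_self_sqrt hμ0.le
  -- At least half of the mass lies in this central window. Translating the window by `T` moves it
  -- above `a p + t`, and the cost of translation is controlled atom by atom.
  have hW : 1 / 2 ≤ (binomial a p).real {k : ℕ | 2 * r ≤ |(k : ℝ) - a * p|}ᶜ := by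
    rw [probReal_compl_eq_one_sub .of_discrete]
    have := binomial_real_abs_sub_ge_le (s := 2 * r) (by linarith) a p
    have e : (a : ℝ) * p / (2 * r) ^ 2 = 1 / 4 := by
      rw [← hrr]; field_simp; norm_num
    linarith
  have hfin : {k : ℕ | 2 * r ≤ |(k : ℝ) - a * p|}ᶜ.Finite := by
    refine (Set.finite_Iic ⌈(a : ℝ) * p + 2 * r⌉₊).subset fun k hk => ?_
    simp only [Set.mem_compl_iff, Set.mem_ofPred_eq, not_le, abs_lt] at hk
    have : (k : ℝ) ≤ ⌈(a : ℝ) * p + 2 * r⌉₊ := le_trans (by linarith) (Nat.le_ceil _)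
    exact_mod_cast this
  set T := ⌈t + 2 * r⌉₊ with hTdef
  have hT1 : t + 2 * r ≤ T := Nat.le_ceil _
  have hT2 : (T : ℝ) < t + 2 * r + 1 := Nat.ceil_lt_add_one (by linarith)
  have hx' : (6 * t + 1) / (a * p) ≤ 7 * t / (a * p) := by gcongr; linarith
  have hx : (6 * t + 1) / (a * p) ≤ ε / 2 := by
    refine hx'.trans ?_
    rw [div_le_iff₀ hμ0]
    linarith
  have each (k : ℕ) (hk : k ∈ hfin.toFinset) :
      Real.exp (-(84 / ε * (t ^ 2 / (a * p)))) * (binomial a p).real {k} ≤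
        (binomial a p).real {k + T} := by
    simp only [Set.Finite.mem_toFinset, Set.mem_compl_iff, Set.mem_ofPred_eq, not_le,
      abs_lt] at hk
    -- Since `1 ≤ r ≤ t`, the endpoint is at most `a p + 2r + (t + 2r + 1) ≤ a p + 6t`. With `6t + 1
    -- ≤ 7t` and `T ≤ 4t` the exponent is `3 * 7 * 4 = 84`.
    refine le_trans ?_ (binomial_real_le_add hε hp hμ0 (s := 6 * t) (by linarith) hx T
        (by linarith))
    refine mul_le_mul_of_nonneg_right ?_ measureReal_nonneg
    rw [Real.exp_le_exp, neg_le_neg_iff]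
    calc 3 / ε * ((6 * t + 1) / (a * p)) * T ≤ 3 / ε * (7 * t / (a * p)) * (4 * t) := by
          gcongr
          · have : 0 ≤ t := by linarith
            positivity
          · linarith
      _ = 84 / ε * (t ^ 2 / (a * p)) := by ring
  have hsum := Finset.sum_le_sum each
  rw [← Finset.mul_sum, sum_measureReal_singleton, hfin.coe_toFinset] at hsum
  have himg := sum_measureReal_singleton (μ := binomial a p) (hfin.toFinset.image (· + T))
  rw [Finset.sum_image (by intro i _ j _ h; simpa using h)] at himg
  rw [himg] at hsum
  calc _ ≤ Real.exp (-(84 / ε * (t ^ 2 / (a * p)))) *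
        (binomial a p).real {k : ℕ | 2 * r ≤ |(k : ℝ) - a * p|}ᶜ := by
        rw [mul_comm]; gcongr
    _ ≤ _ := hsum
    _ ≤ _ := by
      refine measureReal_mono (fun k hk => ?_)
      simp only [Finset.coe_image, Set.Finite.coe_toFinset, Set.mem_image, Set.mem_compl_iff,
        Set.mem_ofPred_eq, not_le, abs_lt] at hk
      obtain ⟨j, hj, rfl⟩ := hk
      simp only [Set.mem_ofPred_eq]
      push_cast
      linarith

end Binomial

/-! ### Random vectors with independent Bernoulli entries -/

section BernoulliVector

variable {V : Type*} [Fintype V] {p : unitInterval} {ε : ℝ}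

/-- The law of a vector indexed by `V` with independent Bernoulli entries. -/
noncomputable def bernoulliVector (V : Type*) [Fintype V] (p : unitInterval) :
    Measure (V → Bool) :=
  Measure.pi fun _ => bernoulliMeasure true false p

instance : IsProbabilityMeasure (bernoulliVector V p) := by
  unfold bernoulliVector; infer_instance

/-- The number of entries `true` of a vector. -/
def trueCount (x : V → Bool) : ℕ :=
  (Finset.univ.filter fun v => x v = true).card

/-- The sum of the signs `ψ v` over the entries `true` of a vector. -/
def signedSum (ψ : V → ℤˣ) (x : V → Bool) : ℤ :=
  ∑ v with x v = true, (ψ v : ℤ)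

theorem bernoulliVector_real_singleton (x : V → Bool) :
    (bernoulliVector V p).real {x} =
      (p : ℝ) ^ trueCount x * (1 - p) ^ (Fintype.card V - trueCount x) := by
  have h (b : Bool) :
      (bernoulliMeasure true false p).real {b} = if b = true then (p : ℝ) else 1 - p := by
    cases b <;> simp
  classical
  rw [bernoulliVector, measureReal_def, Measure.pi_singleton, ENNReal.toReal_prod]
  simp only [← measureReal_def, h]
  rw [Finset.prod_ite, Finset.prod_const, Finset.prod_const, Finset.filter_not,
    Finset.card_sdiff_of_subset (Finset.filter_subset _ _), Finset.card_univ, trueCount]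

theorem card_trueCount_eq (V : Type*) [Fintype V] [DecidableEq V] (k : ℕ) :
    (Finset.univ.filter fun x : V → Bool => trueCount x = k).card = (Fintype.card V).choose k := by
  rw [← Finset.card_univ (α := V), ← Finset.card_powersetCard]
  refine Finset.card_nbij' (fun x => Finset.univ.filter fun v => x v = true)
    (fun s v => decide (v ∈ s)) ?_ ?_ ?_ ?_
  · intro x hx
    rw [Finset.mem_coe, Finset.mem_filter] at hx
    exact Finset.mem_coe.2 (Finset.mem_powersetCard.2 ⟨Finset.subset_univ _, hx.2⟩)
  · intro s hs
    rw [Finset.mem_coe, Finset.mem_filter]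
    simpa [trueCount, Finset.mem_powersetCard] using hs
  · intro x _
    ext v
    simp
  · intro s _
    ext v
    simp

theorem map_trueCount_bernoulliVector (V : Type*) [Fintype V] (p : unitInterval) :
    (bernoulliVector V p).map trueCount = binomial (Fintype.card V) p := by
  classical
  have : IsProbabilityMeasure ((bernoulliVector V p).map trueCount) :=
    Measure.isProbabilityMeasure_map (measurable_of_finite _).aemeasurable
  refine Measure.ext_of_measureReal_singleton fun k => ?_
  rw [map_measureReal_apply (measurable_of_finite _) (measurableSet_singleton k),
    binomial_real_singleton]
  have e : trueCount ⁻¹' {k} =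
      ((Finset.univ.filter fun x : V → Bool => trueCount x = k : Finset _) : Set (V → Bool)) := by
    ext; simp
  rw [e, ← sum_measureReal_singleton, Finset.sum_congr rfl fun x hx => by
    rw [bernoulliVector_real_singleton, (Finset.mem_filter.1 hx).2],
    Finset.sum_const, card_trueCount_eq, nsmul_eq_mul, mul_assoc]

theorem signedSum_eq_trueCount_sub (ψ : V → ℤˣ) (x : V → Bool) :
    signedSum ψ x = (trueCount fun v : {v // ψ v = 1} => x v) -
      (trueCount fun v : {v // ¬ ψ v = 1} => x v) := by
  classical
  have h (v : V) : (ψ v : ℤ) = (if ψ v = 1 then 1 else 0) - (if ¬ ψ v = 1 then 1 else 0) := by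
    rcases Int.units_eq_one_or (ψ v) with h | h <;> simp [h]
  have c (P : V → Prop) [DecidablePred P] :
      ((trueCount fun v : {v // P v} => x v : ℕ) : ℤ) =
        ∑ v with x v = true, if P v then 1 else 0 := by
    rw [trueCount, Finset.sum_boole, Finset.filter_filter, Nat.cast_inj]
    refine Finset.card_nbij Subtype.val ?_ Subtype.val_injective.injOn ?_
    · intro v hv
      simpa [v.2] using hv
    · intro v hv
      simp only [Finset.coe_filter, Finset.mem_univ, true_and, Set.mem_ofPred_eq] at hv
      exact ⟨⟨v, hv.2⟩, by simpa using hv.1, rfl⟩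
  rw [c, c, signedSum, ← Finset.sum_sub_distrib]
  exact Finset.sum_congr rfl fun v _ => h v

theorem map_signedSum_bernoulliVector (ψ : V → ℤˣ) :
    (bernoulliVector V p).map (signedSum ψ) =
      ((binomial (Fintype.card {v // ψ v = 1}) p).prod
        (binomial (Fintype.card {v // ¬ ψ v = 1}) p)).map (fun z : ℕ × ℕ => (z.1 : ℤ) - z.2) := by
  rw [← map_trueCount_bernoulliVector, ← map_trueCount_bernoulliVector,
    Measure.map_prod_map _ _ (measurable_of_finite _) (measurable_of_finite _),
    Measure.map_map .of_discrete (measurable_of_finite _)]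
  have h := (measurePreserving_piEquivPiSubtypeProd
    (fun _ : V => bernoulliMeasure true false p) (fun v => ψ v = 1)).map_eq
  unfold bernoulliVector
  rw [← h, Measure.map_map (measurable_of_finite _) (MeasurableEquiv.measurable _)]
  congr 1
  ext x
  exact signedSum_eq_trueCount_sub ψ x

theorem card_eq_one_add_card_ne_one (ψ : V → ℤˣ) :
    Fintype.card {v // ψ v = 1} + Fintype.card {v // ¬ ψ v = 1} = Fintype.card V := by
  rw [Fintype.card_subtype_compl]
  have := Fintype.card_subtype_le fun v => ψ v = 1
  omega

theorem half_card_le_or (ψ : V → ℤˣ) :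
    (Fintype.card V : ℝ) / 2 ≤ Fintype.card {v // ψ v = 1} ∨
      (Fintype.card V : ℝ) / 2 ≤ Fintype.card {v // ¬ ψ v = 1} := by
  have : (Fintype.card {v // ψ v = 1} : ℝ) + Fintype.card {v // ¬ ψ v = 1} = Fintype.card V := by
    exact_mod_cast card_eq_one_add_card_ne_one ψ
  by_contra! h
  linarith [h.1, h.2]

theorem prod_measureReal_le_of_preimage_left {α β : Type*} [MeasurableSpace α] [MeasurableSpace β]
    (μ : Measure α) (ν : Measure β) [IsProbabilityMeasure μ] [IsProbabilityMeasure ν]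
    {s : Set (α × β)} (hs : MeasurableSet s) {r : ℝ} (hr : 0 ≤ r)
    (h : ∀ y, μ.real ((fun x => (x, y)) ⁻¹' s) ≤ r) : (μ.prod ν).real s ≤ r := by
  refine ENNReal.toReal_le_of_le_ofReal hr ?_
  rw [Measure.prod_apply_symm hs]
  calc _ ≤ ∫⁻ _, ENNReal.ofReal r ∂ν := by
        refine lintegral_mono fun y => ?_
        exact (ENNReal.le_ofReal_iff_toReal_le (measure_ne_top _ _) hr).2 (h y)
    _ = _ := by simp

theorem prod_measureReal_le_of_preimage_right {α β : Type*} [MeasurableSpace α] [MeasurableSpace β]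
    (μ : Measure α) (ν : Measure β) [IsProbabilityMeasure μ] [IsProbabilityMeasure ν]
    {s : Set (α × β)} (hs : MeasurableSet s) {r : ℝ} (hr : 0 ≤ r)
    (h : ∀ x, ν.real (Prod.mk x ⁻¹' s) ≤ r) : (μ.prod ν).real s ≤ r := by
  refine ENNReal.toReal_le_of_le_ofReal hr ?_
  rw [Measure.prod_apply hs]
  calc _ ≤ ∫⁻ _, ENNReal.ofReal r ∂μ := by
        refine lintegral_mono fun y => ?_
        exact (ENNReal.le_ofReal_iff_toReal_le (measure_ne_top _ _) hr).2 (h y)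
    _ = _ := by simp

theorem bernoulliVector_real_signedSum_eq_le (hε : 0 < ε) (hp : (p : ℝ) ≤ 1 - ε)
    (hμ : 0 < (p : ℝ) * Fintype.card V) (ψ : V → ℤˣ) (k : ℤ) :
    (bernoulliVector V p).real {x | signedSum ψ x = k} ≤
      2 * Real.exp (12 / ε) / √(p * Fintype.card V) := by
  have hp0 : (0 : ℝ) ≤ p := p.2.1
  have atom (a : ℕ) (ha : (Fintype.card V : ℝ) / 2 ≤ a) (s : Set ℕ) (hs : s.Subsingleton) :
      (binomial a p).real s ≤ 2 * Real.exp (12 / ε) / √(p * Fintype.card V) := by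
    have h1 : (p : ℝ) * Fintype.card V / 2 ≤ a * p := by nlinarith
    rcases hs.eq_empty_or_singleton with rfl | ⟨j, rfl⟩
    · simp only [measureReal_empty]; positivity
    refine (binomial_real_singleton_le hε hp (by linarith) j).trans ?_
    rw [mul_comm 2, mul_div_assoc, div_eq_mul_inv]
    refine mul_le_mul_of_nonneg_left ?_ (Real.exp_pos _).le
    rw [inv_le_comm₀ (Real.sqrt_pos.2 (by linarith)) (by positivity), inv_div]
    refine Real.le_sqrt_of_sq_le ?_
    rw [div_pow, Real.sq_sqrt hμ.le]
    linarith
  have e : (bernoulliVector V p).real {x | signedSum ψ x = k} =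
      ((bernoulliVector V p).map (signedSum ψ)).real {k} := by
    rw [map_measureReal_apply (measurable_of_finite _) (measurableSet_singleton k)]
    rfl
  rw [e, map_signedSum_bernoulliVector,
    map_measureReal_apply .of_discrete (measurableSet_singleton k)]
  -- Condition on the smaller side of the difference being arbitrary: once the count on the other
  -- class is fixed, at most one value of the count on the class with at least half of the vertices
  -- gives the sum `k`.
  rcases half_card_le_or ψ with h | h
  · refine prod_measureReal_le_of_preimage_left _ _ .of_discrete (by positivity) fun y => ?_
    refine atom _ h _ fun i hi j hj => ?_
    simp only [Set.mem_preimage, Set.mem_singleton_iff] at hi hj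
    omega
  · refine prod_measureReal_le_of_preimage_right _ _ .of_discrete (by positivity) fun y => ?_
    refine atom _ h _ fun i hi j hj => ?_
    simp only [Set.mem_preimage, Set.mem_singleton_iff] at hi hj
    omega

/-- Small ball estimate for signed sums. -/
theorem bernoulliVector_real_natAbs_signedSum_lt_le (hε : 0 < ε) (hp : (p : ℝ) ≤ 1 - ε)
    (hμ : 0 < (p : ℝ) * Fintype.card V) (ψ : V → ℤˣ) {t : ℝ} (ht : 1 ≤ t) :
    (bernoulliVector V p).real {x | ((signedSum ψ x).natAbs : ℝ) < t} ≤
      6 * Real.exp (12 / ε) * t / √(p * Fintype.card V) := by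
  have hsub : {x : V → Bool | ((signedSum ψ x).natAbs : ℝ) < t} ⊆
      ⋃ k ∈ Finset.Icc (-(⌊t⌋₊ : ℤ)) ⌊t⌋₊, {x | signedSum ψ x = k} := by
    intro x hx
    simp only [Set.mem_ofPred_eq] at hx
    have : (signedSum ψ x).natAbs ≤ ⌊t⌋₊ := Nat.le_floor hx.le
    simp only [Set.mem_iUnion, Finset.mem_Icc, Set.mem_ofPred_eq, exists_prop]
    exact ⟨_, by omega, rfl⟩
  have hfl : (⌊t⌋₊ : ℝ) ≤ t := Nat.floor_le (by linarith)
  calc _ ≤ (bernoulliVector V p).real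
        (⋃ k ∈ Finset.Icc (-(⌊t⌋₊ : ℤ)) ⌊t⌋₊, {x | signedSum ψ x = k}) :=
        measureReal_mono hsub (measure_ne_top _ _)
    _ ≤ ∑ k ∈ Finset.Icc (-(⌊t⌋₊ : ℤ)) ⌊t⌋₊, (bernoulliVector V p).real {x | signedSum ψ x = k} :=
        measureReal_biUnion_finset_le _ _
    _ ≤ ∑ k ∈ Finset.Icc (-(⌊t⌋₊ : ℤ)) ⌊t⌋₊, 2 * Real.exp (12 / ε) / √(p * Fintype.card V) :=
        Finset.sum_le_sum fun k _ => bernoulliVector_real_signedSum_eq_le hε hp hμ ψ k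
    _ = (2 * ⌊t⌋₊ + 1) * (2 * Real.exp (12 / ε) / √(p * Fintype.card V)) := by
        rw [Finset.sum_const, Int.card_Icc, nsmul_eq_mul]
        congr 1
        have : ((⌊t⌋₊ : ℤ) + 1 - -(⌊t⌋₊ : ℤ)).toNat = 2 * ⌊t⌋₊ + 1 := by omega
        rw [this]; push_cast; ring
    _ ≤ (3 * t) * (2 * Real.exp (12 / ε) / √(p * Fintype.card V)) := by gcongr; linarith
    _ = _ := by ring

/-- A difference of independent binomial variables with the same success probability exceeds `t`
with at least a Gaussian probability. -/
theorem le_prod_binomial_real_tail {a b : ℕ} {t N : ℝ} (hε : 0 < ε) (hp : (p : ℝ) ≤ 1 - ε)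
    (ha : N / 2 ≤ a) (hb : b ≤ a) (haN : a ≤ N) (hN : 2 ≤ p * N) (ht : 2 * (p * N) ≤ t ^ 2)
    (ht0 : 0 ≤ t) (ht' : t ≤ ε * (p * N) / 56) :
    1 / 4 * Real.exp (-(672 / ε * (t ^ 2 / (p * N)))) ≤
      ((binomial a p).prod (binomial b p)).real {z : ℕ × ℕ | (z.2 : ℝ) + t ≤ z.1} := by
  have hp0 : (0 : ℝ) ≤ p := p.2.1
  have hba : (b : ℝ) ≤ a := by exact_mod_cast hb
  have h1 : p * N / 2 ≤ a * p := by nlinarith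
  have h2 : (a : ℝ) * p ≤ p * N := by nlinarith
  have h3 : (b : ℝ) * p ≤ a * p := by nlinarith
  have ht1 : 0 < t := by nlinarith
  -- The larger class overshoots its mean by `2t` while the other exceeds its own by less than `t`;
  -- as `b ≤ a`, the difference of means only helps.
  have hA := le_binomial_real_tail (a := a) (p := p) (t := 2 * t) hε hp (by linarith)
    (Real.sqrt_le_iff.2 ⟨by linarith, by nlinarith⟩) (by nlinarith)
  have hA' : 1 / 2 * Real.exp (-(672 / ε * (t ^ 2 / (p * N)))) ≤
      (binomial a p).real {k : ℕ | (a : ℝ) * p + 2 * t ≤ k} := by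
    refine le_trans ?_ hA
    refine mul_le_mul_of_nonneg_left ?_ (by norm_num)
    rw [Real.exp_le_exp, neg_le_neg_iff]
    calc 84 / ε * ((2 * t) ^ 2 / (a * p)) ≤ 84 / ε * ((2 * t) ^ 2 / (p * N / 2)) := by
          gcongr
      _ = 672 / ε * (t ^ 2 / (p * N)) := by field_simp; norm_num
  have hB : 1 / 2 ≤ (binomial b p).real {k : ℕ | t ≤ |(k : ℝ) - b * p|}ᶜ := by
    rw [probReal_compl_eq_one_sub .of_discrete]
    have := binomial_real_abs_sub_ge_le ht1 b p
    have : (b : ℝ) * p / t ^ 2 ≤ 1 / 2 := by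
      rw [div_le_iff₀ (by positivity)]
      linarith
    linarith
  calc _ = 1 / 2 * Real.exp (-(672 / ε * (t ^ 2 / (p * N)))) * (1 / 2) := by ring
    _ ≤ (binomial a p).real {k : ℕ | (a : ℝ) * p + 2 * t ≤ k} *
        (binomial b p).real {k : ℕ | t ≤ |(k : ℝ) - b * p|}ᶜ := by gcongr
    _ = ((binomial a p).prod (binomial b p)).real
        ({k : ℕ | (a : ℝ) * p + 2 * t ≤ k} ×ˢ {k : ℕ | t ≤ |(k : ℝ) - b * p|}ᶜ) :=
        (measureReal_prod_prod _ _).symm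
    _ ≤ _ := by
        refine measureReal_mono fun z hz => ?_
        simp only [Set.mem_prod, Set.mem_ofPred_eq, Set.mem_compl_iff, not_le, abs_lt] at hz ⊢
        linarith [hz.1, hz.2.2]

/-- A signed sum is at least `t` in absolute value with at least a Gaussian probability. -/
theorem le_bernoulliVector_real_natAbs_signedSum {t : ℝ} (hε : 0 < ε) (hp : (p : ℝ) ≤ 1 - ε)
    (ψ : V → ℤˣ) (hN : 2 ≤ (p : ℝ) * Fintype.card V) (ht : 2 * ((p : ℝ) * Fintype.card V) ≤ t ^ 2)
    (ht0 : 0 ≤ t) (ht' : t ≤ ε * (p * Fintype.card V) / 56) :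
    1 / 4 * Real.exp (-(672 / ε * (t ^ 2 / (p * Fintype.card V)))) ≤
      (bernoulliVector V p).real {x | t ≤ ((signedSum ψ x).natAbs : ℝ)} := by
  have e : (bernoulliVector V p).real {x | t ≤ ((signedSum ψ x).natAbs : ℝ)} =
      ((bernoulliVector V p).map (signedSum ψ)).real {k : ℤ | t ≤ (k.natAbs : ℝ)} := by
    rw [map_measureReal_apply (measurable_of_finite _) .of_discrete]
    rfl
  have hcard : (Fintype.card {v // ψ v = 1} : ℝ) + Fintype.card {v // ¬ ψ v = 1} =
      Fintype.card V := by exact_mod_cast card_eq_one_add_card_ne_one ψ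
  rw [e, map_signedSum_bernoulliVector, map_measureReal_apply .of_discrete .of_discrete]
  rcases le_total (Fintype.card {v // ¬ ψ v = 1}) (Fintype.card {v // ψ v = 1}) with h | h
  · have h' : (Fintype.card {v // ¬ ψ v = 1} : ℝ) ≤ Fintype.card {v // ψ v = 1} := by
      exact_mod_cast h
    refine (le_prod_binomial_real_tail hε hp (by linarith) h
      (by linarith [Nat.cast_nonneg (α := ℝ) (Fintype.card {v // ¬ ψ v = 1})]) hN ht ht0 ht').trans (measureReal_mono fun z hz => ?_)
    simp only [Set.mem_ofPred_eq, Set.mem_preimage, Nat.cast_natAbs, Int.cast_abs] at hz ⊢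
    push_cast
    exact le_trans (by linarith) (le_abs_self _)
  · have h' : (Fintype.card {v // ψ v = 1} : ℝ) ≤ Fintype.card {v // ¬ ψ v = 1} := by
      exact_mod_cast h
    rw [← Measure.prod_swap, map_measureReal_apply measurable_swap .of_discrete]
    refine (le_prod_binomial_real_tail hε hp (by linarith) h
      (by linarith [Nat.cast_nonneg (α := ℝ) (Fintype.card {v // ψ v = 1})]) hN ht ht0 ht').trans (measureReal_mono fun z hz => ?_)
    simp only [Set.mem_ofPred_eq, Set.mem_preimage, Nat.cast_natAbs, Int.cast_abs, Prod.fst_swap,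
      Prod.snd_swap] at hz ⊢
    push_cast
    rw [abs_sub_comm]
    exact le_trans (by linarith) (le_abs_self _)

/-- For `X` binomial, `2 P(X even) - 1 = E[(-1)^X] = (1 - 2p)^n`, which is at most `exp (-2εpn)`
because `p` stays away from `1`. -/
theorem bernoulliVector_real_even_trueCount_le (hε : 0 < ε) (hp : (p : ℝ) ≤ 1 - ε)
    (hμ : 1 ≤ ε * ((p : ℝ) * Fintype.card V)) :
    (bernoulliVector V p).real {x | Even (trueCount x)} ≤ 3 / 4 := by
  set n := Fintype.card V with hn
  have hp0 : (0 : ℝ) ≤ p := p.2.1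
  have e : (bernoulliVector V p).real {x | Even (trueCount x)} =
      (binomial n p).real {k | Even k} := by
    rw [hn, ← map_trueCount_bernoulliVector,
      map_measureReal_apply (measurable_of_finite _) .of_discrete]
    rfl
  have h1 : ∫ k : ℕ, (-1 : ℝ) ^ k ∂(binomial n p) = (1 - 2 * p) ^ n := by
    rw [integral_binomial]
    have e : Finset.Iic n = Finset.range (n + 1) := by ext; simp
    have := add_pow (-(p : ℝ)) (1 - p) n
    rw [show (1 - 2 * (p : ℝ)) = -p + (1 - p) by ring, this, e]
    refine Finset.sum_congr rfl fun k _ => ?_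
    rw [neg_pow, smul_eq_mul]
    ring
  have h2 : ∫ k : ℕ, (-1 : ℝ) ^ k ∂(binomial n p) = 2 * (binomial n p).real {k | Even k} - 1 := by
    have e (k : ℕ) : (-1 : ℝ) ^ k = 2 * Set.indicator {k : ℕ | Even k} 1 k - 1 := by
      rcases Nat.even_or_odd k with h | h
      · rw [Set.indicator_of_mem (by exact h), h.neg_one_pow]; norm_num
      · rw [Set.indicator_of_notMem (by simpa using h), h.neg_one_pow]; norm_num
    simp_rw [e]
    rw [integral_sub (integrable_binomial _) (integrable_binomial _), integral_const_mul,
      integral_indicator_one .of_discrete]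
    simp
  have h3 : |1 - 2 * (p : ℝ)| ≤ Real.exp (-(2 * ε * p)) := by
    have h := Real.add_one_le_exp (-(2 * ε * p))
    have hp1 : ε * p ≤ ε := mul_le_of_le_one_right hε.le p.2.2
    have hε1 : ε * p ≤ p := by nlinarith
    rw [abs_le]
    constructor <;> linarith
  have h4 : (1 - 2 * (p : ℝ)) ^ n ≤ 1 / 2 := by
    calc (1 - 2 * (p : ℝ)) ^ n ≤ |1 - 2 * (p : ℝ)| ^ n := by
          rw [← abs_pow]; exact le_abs_self _
      _ ≤ Real.exp (-(2 * ε * p)) ^ n := by gcongr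
      _ = Real.exp (-(2 * (ε * (p * n)))) := by rw [← Real.exp_nat_mul]; ring_nf
      _ ≤ 1 / 2 := by
          rw [Real.exp_neg, one_div]
          gcongr
          have := Real.add_one_le_exp (2 * (ε * (p * n)))
          linarith
  rw [e]
  linarith

end BernoulliVector

/-! ### Discrepancy of the edge-independent random hypergraph -/

section RandomHypergraph

variable {n m : ℕ} {p : unitInterval} {ε : ℝ}

theorem bernoulliMatrix_real_forall_mem (n m : ℕ) (p : unitInterval) (E : Set (Fin n → Bool)) :
    (bernoulliMatrix n m p).real {A | ∀ i, A i ∈ E} =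
      (bernoulliVector (Fin n) p).real E ^ m := by
  have e : {A : Fin m → Fin n → Bool | ∀ i, A i ∈ E} = Set.univ.pi fun _ => E := by
    ext A; simp
  have h : bernoulliMatrix n m p = Measure.pi fun _ : Fin m => bernoulliVector (Fin n) p := rfl
  rw [h, e, measureReal_def, Measure.pi_pi, Finset.prod_const, Finset.card_univ,
    Fintype.card_fin, ENNReal.toReal_pow, measureReal_def]

theorem edgeIndependent_real_apply (n m : ℕ) (p : unitInterval)
    (S : Set (MultiHypergraph (Fin n) (Fin m))) :
    (edgeIndependent n m p).real S =
      (bernoulliMatrix n m p).real (MultiHypergraph.ofIncidence ⁻¹' S) :=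
  map_measureReal_apply (measurable_ofIncidence n m) MeasurableSpace.measurableSet_top

theorem edgeDisc_ofIncidence {V ι : Type*} [Fintype V] (A : ι → V → Bool) (ψ : V → ℤˣ) (i : ι) :
    (MultiHypergraph.ofIncidence A).edgeDisc ψ i = (signedSum ψ (A i)).natAbs := rfl

theorem exists_edgeDisc_le_disc {V ι : Type*} [Fintype V] [DecidableEq V] [Fintype ι]
    (H : MultiHypergraph V ι) : ∃ ψ : V → ℤˣ, ∀ i, H.edgeDisc ψ i ≤ H.disc := by
  obtain ⟨ψ, -, hψ⟩ := Finset.exists_mem_eq_inf' (Finset.univ_nonempty (α := V → ℤˣ))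
    fun ψ : V → ℤˣ => H.colouringDisc ψ
  refine ⟨ψ, fun i => ?_⟩
  rw [MultiHypergraph.disc, hψ]
  exact Finset.le_sup (f := fun i => H.edgeDisc ψ i) (Finset.mem_univ i)

/-- The first moment bound over all colourings. -/
theorem edgeIndependent_real_disc_lt_le {t r : ℝ}
    (h : ∀ ψ : Fin n → ℤˣ,
      (bernoulliVector (Fin n) p).real {x | ((signedSum ψ x).natAbs : ℝ) < t} ≤ r) :
    (edgeIndependent n m p).real {H | (H.disc : ℝ) < t} ≤ 2 ^ n * r ^ m := by
  rw [edgeIndependent_real_apply]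
  have hsub : (MultiHypergraph.ofIncidence ⁻¹' {H | (H.disc : ℝ) < t} :
      Set (Fin m → Fin n → Bool)) ⊆
      ⋃ ψ ∈ (Finset.univ : Finset (Fin n → ℤˣ)),
        {A | ∀ i, A i ∈ {x | ((signedSum ψ x).natAbs : ℝ) < t}} := by
    intro A hA
    obtain ⟨ψ, hψ⟩ := exists_edgeDisc_le_disc (MultiHypergraph.ofIncidence A)
    simp only [Set.mem_iUnion, Finset.mem_univ, exists_prop, true_and]
    refine ⟨ψ, fun i => show ((signedSum ψ (A i)).natAbs : ℝ) < t from lt_of_le_of_lt ?_ hA⟩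
    rw [← edgeDisc_ofIncidence]
    exact_mod_cast hψ i
  calc _ ≤ _ := measureReal_mono hsub (measure_ne_top _ _)
    _ ≤ ∑ ψ : Fin n → ℤˣ, (bernoulliMatrix n m p).real
        {A | ∀ i, A i ∈ {x | ((signedSum ψ x).natAbs : ℝ) < t}} :=
        measureReal_biUnion_finset_le _ _
    _ ≤ ∑ ψ : Fin n → ℤˣ, r ^ m := by
        refine Finset.sum_le_sum fun ψ _ => ?_
        rw [bernoulliMatrix_real_forall_mem]
        exact pow_le_pow_left₀ measureReal_nonneg (h ψ) m
    _ = _ := by simp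

theorem even_signedSum_iff {V : Type*} [Fintype V] (ψ : V → ℤˣ) (x : V → Bool) :
    Even (signedSum ψ x) ↔ Even (trueCount x) := by
  have h : Even (signedSum ψ x - trueCount x) := by
    rw [signedSum, trueCount, Finset.card_eq_sum_ones, Nat.cast_sum, ← Finset.sum_sub_distrib]
    refine Finset.even_sum _ fun v _ => ?_
    rcases Int.units_eq_one_or (ψ v) with h | h <;> simp [h]
  rw [Int.even_sub] at h
  rw [h, Int.even_coe_nat]

/-- The parity of a signed sum does not depend on the colouring, so no factor `2 ^ n` is lost. -/
theorem edgeIndependent_real_disc_eq_zero_le (n m : ℕ) (p : unitInterval) :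
    (edgeIndependent n m p).real {H | H.disc = 0} ≤
      (bernoulliVector (Fin n) p).real {x | Even (trueCount x)} ^ m := by
  rw [edgeIndependent_real_apply, ← bernoulliMatrix_real_forall_mem]
  refine measureReal_mono (fun A hA i => ?_) (measure_ne_top _ _)
  obtain ⟨ψ, hψ⟩ := exists_edgeDisc_le_disc (MultiHypergraph.ofIncidence A)
  have h := hψ i
  rw [Set.mem_preimage, Set.mem_ofPred_eq] at hA
  rw [hA, Nat.le_zero, edgeDisc_ofIncidence, Int.natAbs_eq_zero] at h
  rw [Set.mem_ofPred_eq, ← even_signedSum_iff ψ, h]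
  exact Even.zero

theorem edgeIndependent_real_disc_lt_max_le {c : ℝ} (hε : 0 < ε) (hp : (p : ℝ) ≤ 1 - ε)
    (hμ : 1 ≤ ε * ((p : ℝ) * n)) (hm : m ≠ 0) (hc1 : c ≤ 1)
    (hc : c ≤ Real.exp (-(12 / ε)) / 12) :
    (edgeIndependent n m p).real
      {H | (H.disc : ℝ) < c * max ((2 : ℝ) ^ (-((n : ℝ) / m)) * √(p * n)) 1} ≤ (3 / 4) ^ m := by
  set x := (2 : ℝ) ^ (-((n : ℝ) / m)) * √(p * n) with hx
  -- If `c * x ≤ 1` the threshold is at most `1`, and an integer discrepancy below it vanishes.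
  -- Otherwise the threshold is at least `1`, as the small ball estimate requires.
  rcases le_or_gt (c * x) 1 with h | h
  · have hsub : {H : MultiHypergraph (Fin n) (Fin m) | (H.disc : ℝ) < c * max x 1} ⊆
        {H | H.disc = 0} := by
      intro H hH
      have h1 : c * max x 1 ≤ 1 := by
        rcases max_choice x 1 with e | e <;> rw [e] <;> linarith
      have : (H.disc : ℝ) < 1 := lt_of_lt_of_le hH h1
      exact Nat.lt_one_iff.1 (by exact_mod_cast this)
    refine (measureReal_mono hsub (measure_ne_top _ _)).trans
      ((edgeIndependent_real_disc_eq_zero_le n m p).trans ?_)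
    refine pow_le_pow_left₀ measureReal_nonneg ?_ m
    exact bernoulliVector_real_even_trueCount_le hε hp (by simpa using hμ)
  · have hx0 : 0 ≤ x := by positivity
    have hx1 : 1 ≤ x := by nlinarith
    rw [max_eq_left hx1]
    have hμ0 : 0 < (p : ℝ) * n := by
      by_contra! h0
      nlinarith
    have hs : 0 < √((p : ℝ) * n) := Real.sqrt_pos.2 hμ0
    have h2 : (0 : ℝ) < 2 ^ (-((n : ℝ) / m)) := by positivity
    refine (edgeIndependent_real_disc_lt_le (r := 1 / 2 * 2 ^ (-((n : ℝ) / m)))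
      fun ψ => ?_).trans ?_
    · have := bernoulliVector_real_natAbs_signedSum_lt_le hε hp (by simpa using hμ0) ψ h.le
      rw [Fintype.card_fin] at this
      refine this.trans ?_
      rw [div_le_iff₀ hs, hx]
      have hE : Real.exp (12 / ε) * c ≤ 1 / 12 := by
        calc Real.exp (12 / ε) * c ≤ Real.exp (12 / ε) * (Real.exp (-(12 / ε)) / 12) := by gcongr
          _ = 1 / 12 := by rw [Real.exp_neg]; field_simp
      calc 6 * Real.exp (12 / ε) * (c * (2 ^ (-((n : ℝ) / m)) * √(p * n)))
          = 6 * (Real.exp (12 / ε) * c) * 2 ^ (-((n : ℝ) / m)) * √(p * n) := by ring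
        _ ≤ 6 * (1 / 12) * 2 ^ (-((n : ℝ) / m)) * √(p * n) := by gcongr
        _ = _ := by ring
    · have hm' : (m : ℝ) ≠ 0 := by exact_mod_cast hm
      rw [mul_pow, ← Real.rpow_natCast ((2 : ℝ) ^ (-((n : ℝ) / m))), ← Real.rpow_mul (by norm_num),
        neg_mul, div_mul_cancel₀ _ hm', Real.rpow_neg (by norm_num), Real.rpow_natCast]
      calc (2 : ℝ) ^ n * ((1 / 2) ^ m * (2 ^ n)⁻¹) = (1 / 2) ^ m := by field_simp
        _ ≤ _ := pow_le_pow_left₀ (by norm_num) (by norm_num) m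

/-- `L` stands for `log γ`. With `t = c * √(p n L)`, `hL` and `hLp` place `t` in the range of the
reverse tail bound, and `hLm` keeps that bound above a multiple of `(m/n) ^ (-1/2)`. -/
theorem edgeIndependent_real_disc_lt_sqrt_le {c L : ℝ} (hε : 0 < ε) (hp : (p : ℝ) ≤ 1 - ε)
    (hn : n ≠ 0) (hN : 2 ≤ (p : ℝ) * n) (hc0 : 0 ≤ c) (hc1 : c ≤ 1) (hcε : c ≤ ε / 1344)
    (hL : 2 ≤ c ^ 2 * L) (hLp : L ≤ (ε / 56) ^ 2 * (p * n)) (hLm : L ≤ Real.log ((m : ℝ) / n))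
    (hm : 64 ≤ (m : ℝ) / n) :
    (edgeIndependent n m p).real {H | (H.disc : ℝ) < c * √(p * n * L)} ≤ Real.exp (-n) := by
  have hL0 : 0 < L := by
    by_contra! h
    nlinarith [sq_nonneg c]
  set t := c * √(p * n * L) with ht
  have ht2 : t ^ 2 = c ^ 2 * L * (p * n) := by
    rw [ht, mul_pow, Real.sq_sqrt (by positivity)]
    ring
  have hc2 : c ^ 2 ≤ 1 := pow_le_one₀ hc0 hc1
  have htle : t ≤ ε * (p * n) / 56 := by
    refine abs_le_of_sq_le_sq' ?_ (by positivity) |>.2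
    rw [ht2]
    calc c ^ 2 * L * (p * n) ≤ 1 * ((ε / 56) ^ 2 * (p * n)) * (p * n) := by gcongr
      _ = _ := by ring
  set w := √((m : ℝ) / n) with hw
  have hn0 : (0 : ℝ) < n := by positivity
  have hw8 : 8 ≤ w := Real.le_sqrt_of_sq_le (by norm_num; exact hm)
  have hww : w ^ 2 = m / n := Real.sq_sqrt (by positivity)
  set q := 1 / 4 * w⁻¹ with hq
  have hq1 : q ≤ 1 := by
    have : w⁻¹ ≤ 1 := inv_le_one_of_one_le₀ (by linarith)
    linarith
  have row (ψ : Fin n → ℤˣ) :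
      (bernoulliVector (Fin n) p).real {x | ((signedSum ψ x).natAbs : ℝ) < t} ≤ 1 - q := by
    have h := le_bernoulliVector_real_natAbs_signedSum (t := t) hε hp ψ
      (by simpa using hN) (by rw [Fintype.card_fin, ht2]; gcongr) (by positivity)
      (by simpa using htle)
    have e : {x : Fin n → Bool | ((signedSum ψ x).natAbs : ℝ) < t} =
        {x | t ≤ ((signedSum ψ x).natAbs : ℝ)}ᶜ := by
      ext; simp
    rw [e, probReal_compl_eq_one_sub .of_discrete]
    rw [Fintype.card_fin, ht2, mul_div_cancel_right₀ _ (by positivity)] at h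
    -- The constant `1344 = 2 * 672` makes the exponent at most `L / 2`, hence at most `log (m/n) /
    -- 2`.
    have h2 : w⁻¹ ≤ Real.exp (-(672 / ε * (c ^ 2 * L))) := by
      have hlog : w⁻¹ = Real.exp (-(Real.log (m / n) / 2)) := by
        rw [Real.exp_neg, ← Real.log_sqrt (by positivity), Real.exp_log (by positivity)]
      rw [hlog, Real.exp_le_exp, neg_le_neg_iff]
      have hcc : c ^ 2 ≤ ε / 1344 := by nlinarith
      calc 672 / ε * (c ^ 2 * L) ≤ 672 / ε * (ε / 1344 * L) := by gcongr
        _ = L / 2 := by field_simp; norm_num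
        _ ≤ _ := by linarith
    linarith
  refine (edgeIndependent_real_disc_lt_le row).trans ?_
  have hmn : (m : ℝ) = n * w ^ 2 := by rw [hww]; field_simp
  -- Here `q * m = n * w / 4`, and `w ≥ 8` is the reason for the constant `64`; half of this cancels
  -- `2 ^ n ≤ exp n`.
  have hqm : 2 * (n : ℝ) ≤ q * m := by
    have : q * m = n * w / 4 := by
      rw [hmn, hq]
      have : w ≠ 0 := by positivity
      field_simp
    rw [this]
    nlinarith
  calc (2 : ℝ) ^ n * (1 - q) ^ m ≤ Real.exp 1 ^ n * Real.exp (-q) ^ m := by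
        gcongr
        · linarith [Real.add_one_le_exp (1 : ℝ)]
        · linarith [Real.add_one_le_exp (-q)]
    _ = Real.exp (n - q * m) := by
        rw [← Real.exp_nat_mul, ← Real.exp_nat_mul, ← Real.exp_add]; ring_nf
    _ ≤ _ := Real.exp_le_exp.2 (by linarith)

theorem tendsto_edgeIndependent_real_le_disc {m : ℕ → ℕ} {p : ℕ → unitInterval} {t u : ℕ → ℝ}
    (hu : Tendsto u atTop (𝓝 0))
    (h : ∀ᶠ n in atTop, (edgeIndependent n (m n) (p n)).real {H | (H.disc : ℝ) < t n} ≤ u n) :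
    Tendsto (fun n => (edgeIndependent n (m n) (p n)).real {H | t n ≤ (H.disc : ℝ)})
      atTop (𝓝 1) := by
  refine tendsto_of_tendsto_of_tendsto_of_le_of_le' (g := fun n => 1 - u n)
    (by simpa using hu.const_sub 1) tendsto_const_nhds ?_ (.of_forall fun n => measureReal_le_one)
  filter_upwards [h] with n hn
  have e : {H : MultiHypergraph (Fin n) (Fin (m n)) | t n ≤ (H.disc : ℝ)} =
      {H | (H.disc : ℝ) < t n}ᶜ := by
    ext; simp
  rw [e, probReal_compl_eq_one_sub MeasurableSpace.measurableSet_top]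
  linarith

end RandomHypergraph

theorem theorem1 (ε : ℝ) (hε : 0 < ε) :
    ∃ c : ℝ, 0 < c ∧
      ∀ (m : ℕ → ℕ) (p : ℕ → unitInterval),
        (∀ᶠ n : ℕ in atTop, (p n : ℝ) ≤ 1 - ε) →
        Tendsto (fun n : ℕ => (p n : ℝ) * (n : ℝ)) atTop atTop →
        Tendsto (fun n : ℕ => (p n : ℝ) * (m n : ℝ)) atTop atTop →
        (((fun n : ℕ => (m n : ℝ)) =O[atTop] fun n : ℕ => (n : ℝ)) →
          Tendsto
            (fun n : ℕ => (edgeIndependent n (m n) (p n)).real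
              {H | c * max ((2 : ℝ) ^ (-((n : ℝ) / (m n : ℝ))) * √((p n : ℝ) * (n : ℝ))) 1
                ≤ (H.disc : ℝ)})
            atTop (𝓝 1)) ∧
        (((fun n : ℕ => (n : ℝ)) =o[atTop] fun n : ℕ => (m n : ℝ)) →
          Tendsto
            (fun n : ℕ => (edgeIndependent n (m n) (p n)).real
              {H | c * √((p n : ℝ) * (n : ℝ) *
                    Real.log (min ((m n : ℝ) / (n : ℝ)) ((p n : ℝ) * (n : ℝ))))
                ≤ (H.disc : ℝ)})
            atTop (𝓝 1)) := by
  -- The first entry serves the small ball estimate, the second the reverse tail bound.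
  set c := min (Real.exp (-(12 / ε)) / 12) (ε / 1344) with hc
  have hc0 : 0 < c := by positivity
  have hcE : c ≤ Real.exp (-(12 / ε)) / 12 := min_le_left _ _
  have hcε : c ≤ ε / 1344 := min_le_right _ _
  have hc1 : c ≤ 1 := by
    have : Real.exp (-(12 / ε)) ≤ 1 := Real.exp_le_one_iff.2 (by simp; positivity)
    linarith
  refine ⟨c, hc0, fun m p hp hpn hpm => ⟨fun _ => ?_, fun hnm => ?_⟩⟩
  · have hm : Tendsto m atTop atTop := by
      rw [← tendsto_natCast_atTop_iff (R := ℝ)]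
      refine tendsto_atTop_mono (fun n => ?_) hpm
      exact mul_le_of_le_one_left (Nat.cast_nonneg _) (p n).2.2
    refine tendsto_edgeIndependent_real_le_disc (u := fun n => (3 / 4) ^ m n)
      ((tendsto_pow_atTop_nhds_zero_of_lt_one (by norm_num) (by norm_num)).comp hm) ?_
    filter_upwards [hp, hpn.eventually_ge_atTop (1 / ε), hm.eventually_ne_atTop 0]
      with n hn h1 h2
    rw [div_le_iff₀' hε] at h1
    exact edgeIndependent_real_disc_lt_max_le hε hn h1 h2 hc1 hcE
  · refine tendsto_edgeIndependent_real_le_disc (u := fun n => Real.exp (-(n : ℝ)))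
      (Real.tendsto_exp_neg_atTop_nhds_zero.comp tendsto_natCast_atTop_atTop) ?_
    have hratio (B : ℝ) (hB : 0 < B) : ∀ᶠ n : ℕ in atTop, B ≤ (m n : ℝ) / n := by
      filter_upwards [hnm.bound (c := B⁻¹) (by positivity), eventually_gt_atTop 0] with n h h0
      simp only [Real.norm_natCast] at h
      rw [le_div_iff₀ (by positivity)]
      calc B * n ≤ B * (B⁻¹ * m n) := by gcongr
        _ = m n := by field_simp
    have hlog := hpn.eventually
      (Real.isLittleO_log_id_atTop.bound (c := (ε / 56) ^ 2) (by positivity))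
    -- The threshold `exp (2 / c ^ 2)` for both `m/n` and `pn` gives `c ^ 2 * log γ ≥ 2`, and `log
    -- (pn) = o(pn)` gives the upper bound on `log γ`.
    filter_upwards [hp, hpn.eventually_ge_atTop 2, hratio 64 (by norm_num),
      hratio (Real.exp (2 / c ^ 2)) (Real.exp_pos _),
      hpn.eventually_ge_atTop (Real.exp (2 / c ^ 2)), hlog, eventually_ne_atTop 0]
      with n hn h2 h64 hm hpE hlog h0
    have hmin : Real.exp (2 / c ^ 2) ≤ min ((m n : ℝ) / n) ((p n : ℝ) * n) := le_min hm hpE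
    have hmin0 := (Real.exp_pos _).trans_le hmin
    have hL := (Real.le_log_iff_exp_le hmin0).2 hmin
    refine edgeIndependent_real_disc_lt_sqrt_le hε hn h0 h2 hc0.le hc1 hcε ?_ ?_ ?_ h64
    · rw [div_le_iff₀' (by positivity)] at hL
      exact hL
    · refine (Real.log_le_log hmin0 (min_le_right _ _)).trans ((le_abs_self _).trans ?_)
      rw [id, Real.norm_eq_abs, Real.norm_eq_abs, abs_of_pos (by linarith : (0 : ℝ) < p n * n)]
        at hlog
      exact hlog
    · exact Real.log_le_log hmin0 (min_le_left _ _)
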